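/- Let $k$ be an algebraically closed field of characteristic $p>0$, and let $G$ be a (smooth) linear algebraic group over $k$ with Lie algebra $\mathfrak g$. Let $\mathcal N_p(\mathfrak g)=\{B\in\mathfrak g : B^{[p]}=0\}$, let $\mathcal C_r(\mathcal N_p(\mathfrak g))$ be the variety of $r$-tuples of pairwise commuting elements of $\mathcal N_p(\mathfrak g)$, and let $V_r(G)$ be the variety of homomorphisms $\mathbb G_{a(r)}\to G$ from the $r$-th Frobenius kernel of $\mathbb G_a$. A 1-parameter subgroup of $G$ is a homomorphism $\mathbb G_a\to G$; the set of these is $V(G)$. Suppose $G$ is equipped with a structure of exponential type, that is, a morphism $\mathcal E:\mathcal N_p(\mathfrak g)\times\mathbb G_a\to G$, $(B,s)\mapsto\mathcal E_B(s)$, such that (1) each $\mathcal E_B$ is a 1-parameter subgroup; (2) $\mathcal E_B$ and $\mathcal E_{B'}$ commute whenever $[B,B']=0$; (3) $\mathcal E_{\alpha B}(s)=\mathcal E_B(\alpha s)$ for all $\alpha,s$ in any commutative $k$-algebra; (4) every 1-parameter subgroup has the form $\mathcal E_{\underline B}=\prod_{s=0}^{r-1}(\mathcal E_{B_s}\circ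 F^s)$ with $r>0$, $\underline B\in\mathcal C_r(\mathcal N_p(\mathfrak g))$ and $F$ the Frobenius of $\mathbb G_a$, and for every $r>0$ restricting $\mathcal E_{\underline B}$ to $\mathbb G_{a(r)}$ gives an isomorphism $\mathcal C_r(\mathcal N_p(\mathfrak g))\to V_r(G)$. Write $k[\mathbb G_a]=k[T]$, let $v_j$ be the functional "coefficient of $T^j$" on $k[T]$, and set $u_s=v_{p^s}$. Put $k[G]_{[0]}=\{f\in k[G] : (\mathcal E_{B*}v_j)(f)=0 \text{ for all } B\in\mathcal N_p(\mathfrak g),\ j>0\}$. For a rational $G$-module $M$ (of any dimension) with coaction $\Delta_M:M\to M\otimes k[G]$ put $M_{[0]}=\{m\in M : \Delta_M(m)\in M\otimes k[G]_{[0]}\}$; $M$ is mock trivial if $M=M_{[0]}$. The $p$-nilpotent action at $\mathcal E_{\underline B}$ is the action of $\sum_s(\mathcal E_{B_s})_*(u_s)$ on $M$, and the support variety $V(G)_M\subseteq V(G)$ is the set of those $\mathcal E_{\underline B}$ for which $M$, with $t$ acting by this operator, is not a free $k[t]/t^p$-module. Then $M$ is mock trivial if and only if the pull-back of $M$ along every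 1-parameter subgroup $\psi:\mathbb G_a\to G$ is a trivial $\mathbb G_a$-module. If $M$ is mock trivial, then the $p$-nilpotent action on $M$ at every 1-parameter subgroup of $G$ is zero; and if these actions are all zero and $M\neq 0$, then $V(G)_M=V(G)$. In particular $V(G)_M=V(G)$ for every non-zero mock trivial $M$. -/

import Mathlib

open scoped TensorProduct Polynomial
open WithConv
open scoped Coalgebra

noncomputable section

/-! ### The additive group and its Frobenius kernels -/

namespace AdditiveGroup

variable (k : Type*)

/-- The coordinate algebra `k[X]` of the additive group, with `X ↦ X ⊗ 1 + 1 ⊗ X`, `ε(X) = 0`. -/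
instance instBialgebra [CommRing k] : Bialgebra k k[X] :=
  .ofAlgHom
    (Polynomial.aeval ((Polynomial.X : k[X]) ⊗ₜ[k] (1 : k[X]) + (1 : k[X]) ⊗ₜ[k] Polynomial.X))
    (Polynomial.aeval (0 : k))
    (by
      ext
      simp [Algebra.TensorProduct.one_def, TensorProduct.add_tmul, TensorProduct.tmul_add]
      abel)
    (by ext; simp)
    (by ext; simp)

theorem comul_X [CommRing k] : Coalgebra.comul (R := k) (Polynomial.X : k[X]) =
    (Polynomial.X : k[X]) ⊗ₜ[k] (1 : k[X]) + (1 : k[X]) ⊗ₜ[k] Polynomial.X :=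
  Polynomial.aeval_X _

theorem counit_eq [CommRing k] (f : k[X]) : Coalgebra.counit (R := k) f = Polynomial.aeval 0 f :=
  rfl

/-- The ideal of the `r`-th Frobenius kernel of the additive group. -/
def frobIdeal [CommRing k] (p r : ℕ) : Ideal k[X] := Ideal.span {Polynomial.X ^ p ^ r}

instance instIsCoideal [Field k] (p r : ℕ) [Fact p.Prime] [CharP k p] :
    ((frobIdeal k p r).restrictScalars k).IsCoideal := by
  have hp : 0 < p := (Fact.out : p.Prime).pos
  set I := frobIdeal k p r with hI
  have hmem : (Polynomial.X : k[X]) ^ p ^ r ∈ I := Ideal.subset_span rfl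
  have h0 : Ideal.Quotient.mkₐ k I (Polynomial.X ^ p ^ r) = 0 :=
    Ideal.Quotient.eq_zero_iff_mem.2 hmem
  have key : ∀ x ∈ I, Algebra.TensorProduct.map (Ideal.Quotient.mkₐ k I) (Ideal.Quotient.mkₐ k I)
      (Bialgebra.comulAlgHom k k[X] x) = 0 := by
    intro x hx
    obtain ⟨y, rfl⟩ := Ideal.mem_span_singleton'.1 hx
    have : CharP (k[X] ⊗[k] k[X]) p := charP_of_injective_algebraMap
      (algebraMap k (k[X] ⊗[k] k[X])).injective p
    have : Bialgebra.comulAlgHom k k[X] (Polynomial.X ^ p ^ r) =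
        (Polynomial.X ^ p ^ r) ⊗ₜ[k] (1 : k[X]) + (1 : k[X]) ⊗ₜ[k] (Polynomial.X ^ p ^ r) := by
      rw [map_pow, Bialgebra.comulAlgHom_apply, comul_X, add_pow_char_pow]
      simp [Algebra.TensorProduct.tmul_pow]
    rw [map_mul, map_mul, this, map_add, Algebra.TensorProduct.map_tmul,
      Algebra.TensorProduct.map_tmul, h0]
    simp
  refine ⟨fun x hx => ?_, fun x hx => key x hx⟩
  obtain ⟨y, rfl⟩ := Ideal.mem_span_singleton'.1 (show x ∈ I from hx)
  rw [counit_eq]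
  simp [hp.ne']

end AdditiveGroup

/-! ### Linear algebraic groups, given by their coordinate algebras `A = k[G]` -/

namespace AlgGroup

section Lie

variable (k A : Type*) [Field k] [CommRing A] [HopfAlgebra k A]

instance instLieRingConv : LieRing (WithConv (A →ₗ[k] k)) := LieRing.ofAssociativeRing

instance instLieAlgebraConv : LieAlgebra k (WithConv (A →ₗ[k] k)) :=
  LieAlgebra.ofAssociativeAlgebra

/-- The Lie algebra of `G`: the `ε`-derivations `k[G] → k`, with the commutator bracket of the
convolution algebra `Hom_k(k[G], k)`. The `p`-th power operation is the `p`-th convolution power. -/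
def lieAlg : LieSubalgebra k (WithConv (A →ₗ[k] k)) where
  carrier := {B | ∀ f g : A,
    B (f * g) = Coalgebra.counit (R := k) f * B g + B f * Coalgebra.counit (R := k) g}
  add_mem' := by
    intro a b ha hb f g
    change a (f * g) + b (f * g) = _ * (a g + b g) + (a f + b f) * _
    rw [ha f g, hb f g]
    ring
  zero_mem' := by
    intro f g
    change (0 : k) = _ * 0 + 0 * _
    ring
  smul_mem' := by
    intro c a ha f g
    change c * a (f * g) = _ * (c * a g) + (c * a f) * _
    rw [ha f g]
    ring
  lie_mem' := by
    intro a b ha hb f g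
    have key : ∀ x y : WithConv (A →ₗ[k] k),
        (∀ f g : A, x (f * g) =
          Coalgebra.counit (R := k) f * x g + x f * Coalgebra.counit (R := k) g) →
        (∀ f g : A, y (f * g) =
          Coalgebra.counit (R := k) f * y g + y f * Coalgebra.counit (R := k) g) →
        (x * y) (f * g) = Coalgebra.counit (R := k) f * (x * y) g +
          (x * y) f * Coalgebra.counit (R := k) g + x f * y g + y f * x g := by
      intro x y hx hy
      have e : ∀ (z w : WithConv (A →ₗ[k] k)) (a : A), (z * w) a =
          ∑ i ∈ (ℛ k a).index, z ((ℛ k a).left i) * w ((ℛ k a).right i) :=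
        fun z w a => (ℛ k a).convMul_apply z w
      have e1 : ∀ (w : WithConv (A →ₗ[k] k)) (a : A), w a =
          ∑ i ∈ (ℛ k a).index, Coalgebra.counit (R := k) ((ℛ k a).left i) * w ((ℛ k a).right i) :=
        fun w a => by simpa using e 1 w a
      have e2 : ∀ (w : WithConv (A →ₗ[k] k)) (a : A), w a =
          ∑ i ∈ (ℛ k a).index, w ((ℛ k a).left i) * Coalgebra.counit (R := k) ((ℛ k a).right i) :=
        fun w a => by simpa using e w 1 a
      have e3 : ∀ a : A, Coalgebra.counit (R := k) a =
          ∑ i ∈ (ℛ k a).index, Coalgebra.counit (R := k) ((ℛ k a).left i) *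
            Coalgebra.counit (R := k) ((ℛ k a).right i) :=
        fun a => by simpa using e 1 1 a
      have hm : (x * y) (f * g) = ∑ i ∈ (ℛ k f).index, ∑ j ∈ (ℛ k g).index,
          x ((ℛ k f).left i * (ℛ k g).left j) * y ((ℛ k f).right i * (ℛ k g).right j) := by
        rw [LinearMap.convMul_apply, Bialgebra.comul_mul, ← (ℛ k f).eq, ← (ℛ k g).eq,
          Finset.sum_mul_sum]
        simp
      rw [hm, e x y f, e x y g, e1 y f, e2 x g, e2 x f, e1 y g, e3 f, e3 g]
      simp only [Finset.sum_mul_sum, ← Finset.sum_add_distrib]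
      refine Finset.sum_congr rfl fun i _ => Finset.sum_congr rfl fun j _ => ?_
      rw [hx, hy]
      ring
    change (a * b) (f * g) - (b * a) (f * g) =
      _ * ((a * b) g - (b * a) g) + ((a * b) f - (b * a) f) * _
    rw [key a b ha hb, key b a hb ha]
    ring

/-- The `p`-nilpotent elements `B` of the Lie algebra, `B^[p] = 0`. -/
def nilCone (p : ℕ) : Set (lieAlg k A) := {B | (B : WithConv (A →ₗ[k] k)) ^ p = 0}

/-- The `r`-tuples of pairwise commuting `p`-nilpotent elements of the Lie algebra. -/
def commTuples (p r : ℕ) : Set (Fin r → lieAlg k A) :=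
  {B | (∀ i, B i ∈ nilCone k A p) ∧ ∀ i j, ⁅B i, B j⁆ = 0}

end Lie

/-- The algebra of regular functions on a Zariski closed subset `S` of a finite dimensional vector
space `V`: restrictions to `S` of polynomials in the linear coordinates of `V`. -/
def coordRing {k V : Type*} [Field k] [AddCommGroup V] [Module k V] (S : Set V) :
    Subalgebra k (S → k) :=
  Algebra.adjoin k (Set.range fun (l : Module.Dual k V) (x : S) => l x)

/-- The linear functional `l` of `V` as a regular function on `S`. -/
def coordRing.linear {k V : Type*} [Field k] [AddCommGroup V] [Module k V] (S : Set V)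
    (l : Module.Dual k V) : coordRing (k := k) S :=
  ⟨fun x => l x, Algebra.subset_adjoin ⟨l, rfl⟩⟩

/-- The `k`-point of the variety `S` given by an element of `S`. -/
def coordRing.point {k V : Type*} [Field k] [AddCommGroup V] [Module k V] {S : Set V}
    (x : S) : coordRing (k := k) S →ₐ[k] k :=
  (Pi.evalAlgHom k (fun _ : S => k) x).comp (coordRing (k := k) S).val

/-- A 1-parameter subgroup `𝔾ₐ → G`: a homomorphism of algebraic groups, given by the
homomorphism `k[G] → k[X]` of coordinate algebras. -/
abbrev OneParam (k A : Type*) [Field k] [CommRing A] [HopfAlgebra k A] := A →ₐc[k] k[X]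

/-- The (closed points of the) variety `V_r(G)` of infinitesimal 1-parameter subgroups
`𝔾ₐ₍ᵣ₎ → G` of height `r`. -/
abbrev InfOneParam (k A : Type*) [Field k] [CommRing A] [HopfAlgebra k A]
    (p r : ℕ) [Fact p.Prime] [CharP k p] :=
  A →ₐc[k] k[X] ⧸ AdditiveGroup.frobIdeal k p r

/-- The algebra of regular functions on the variety `V_r(G)`: it is generated by the coefficients
`χ ↦ l (χ f)` of the homomorphisms `χ : k[G] → k[X]/(X ^ p ^ r)`. -/
def infCoordRing (k A : Type*) [Field k] [CommRing A] [HopfAlgebra k A]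
    (p r : ℕ) [Fact p.Prime] [CharP k p] : Subalgebra k (InfOneParam k A p r → k) :=
  Algebra.adjoin k (Set.range
    fun (fl : A × Module.Dual k (k[X] ⧸ AdditiveGroup.frobIdeal k p r))
      (χ : InfOneParam k A p r) => fl.2 (χ fl.1))

section Exp

universe u v

variable {k : Type u} {A : Type v} [Field k] [CommRing A] [HopfAlgebra k A] {p : ℕ}

/-- For a morphism `𝓔 : 𝒩_p × 𝔾ₐ → G`, an `R`-point `b` of `𝒩_p` and `s ∈ 𝔾ₐ(R) = R`, the `R`-point
`𝓔_b(s)` of `G`. -/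
def expPoint (E : A →ₐ[k] (coordRing (k := k) (nilCone k A p))[X])
    {R : Type*} [CommRing R] [Algebra k R]
    (b : coordRing (k := k) (nilCone k A p) →ₐ[k] R) (s : R) : A →ₐ[k] R :=
  (((Polynomial.aeval s : R[X] →ₐ[R] R).restrictScalars k).comp (Polynomial.mapAlgHom b)).comp E

/-- For a morphism `𝓔 : 𝒩_p × 𝔾ₐ → G` and `B ∈ 𝒩_p(k)`, the morphism `𝓔_B : 𝔾ₐ → G`. -/
def expAt (E : A →ₐ[k] (coordRing (k := k) (nilCone k A p))[X]) (B : nilCone k A p) :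
    A →ₐ[k] k[X] :=
  (Polynomial.mapAlgHom (coordRing.point B)).comp E

/-- The morphism `𝓔_B = ∏_{s < r} (𝓔_{B_s} ∘ F^s) : 𝔾ₐ → G`, for a tuple `B = (B_0, …, B_{r-1})`;
the product is the pointwise product of morphisms to the group `G`, i.e. the convolution product,
and `F` is the Frobenius `X ↦ X ^ p`. -/
def expTuple (E : A →ₐ[k] (coordRing (k := k) (nilCone k A p))[X]) {r : ℕ}
    (B : commTuples k A p r) : A →ₐ[k] k[X] :=
  (List.ofFn fun s : Fin r =>
    toConv ((Polynomial.expand k (p ^ (s : ℕ))).comp (expAt E ⟨B.1 s, B.2.1 s⟩))).prod.ofConv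

variable (k A p) in
/-- A structure of exponential type on the linear algebraic group `G` with coordinate
algebra `A`. -/
structure ExpStructure [Fact p.Prime] [CharP k p] where
  /-- the comorphism `k[G] → k[𝒩_p] ⊗ k[𝔾ₐ]` of `𝓔 : 𝒩_p × 𝔾ₐ → G` -/
  E : A →ₐ[k] (coordRing (k := k) (nilCone k A p))[X]
  /-- each `𝓔_B : 𝔾ₐ → G` is a 1-parameter subgroup -/
  oneParam : ∀ B : nilCone k A p, ∃ ψ : OneParam k A, (ψ : A →ₐ[k] k[X]) = expAt E B
  /-- `𝓔_B` and `𝓔_B'` commute if `B` and `B'` do (as an identity of `R`-points of `G`) -/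
  commute : ∀ B B' : nilCone k A p, ⁅(B : lieAlg k A), (B' : lieAlg k A)⁆ = 0 →
    ∀ (R : Type (max u v)) [CommRing R] [Algebra k R] (s t : R),
      Commute (toConv ((Polynomial.aeval s).comp (expAt E B)) : WithConv (A →ₐ[k] R))
        (toConv ((Polynomial.aeval t).comp (expAt E B')))
  /-- `𝓔_{αB}(s) = 𝓔_B(αs)` for `R`-points `B`; here `b'` is the `R`-point `α • b` of `𝒩_p` -/
  smul : ∀ (R : Type (max u v)) [CommRing R] [Algebra k R] (α s : R)
    (b b' : coordRing (k := k) (nilCone k A p) →ₐ[k] R),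
    (∀ l : Module.Dual k (lieAlg k A),
      b' (coordRing.linear _ l) = α * b (coordRing.linear _ l)) →
    expPoint E b' s = expPoint E b (α * s)
  /-- every 1-parameter subgroup is of the form `∏ (𝓔_{B_s} ∘ F^s)` -/
  exists_tuple : ∀ ψ : OneParam k A, ∃ r : ℕ, 0 < r ∧
    ∃ B : commTuples k A p r, (ψ : A →ₐ[k] k[X]) = expTuple E B
  /-- restriction of `∏ (𝓔_{B_s} ∘ F^s)` to the Frobenius kernel `𝔾ₐ₍ᵣ₎` is an isomorphism
  of varieties from the commuting `p`-nilpotent `r`-tuples to `V_r(G)`: a bijection under which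
  the regular functions correspond -/
  iso : ∀ r : ℕ, 0 < r → ∃ φ : commTuples k A p r ≃ InfOneParam k A p r,
    (∀ B, (φ B : A →ₐ[k] k[X] ⧸ AdditiveGroup.frobIdeal k p r) =
      (Ideal.Quotient.mkₐ k (AdditiveGroup.frobIdeal k p r)).comp (expTuple E B)) ∧
    ∀ g : InfOneParam k A p r → k,
      g ∈ infCoordRing k A p r ↔ g ∘ φ ∈ coordRing (k := k) (commTuples k A p r)

end Exp

/-! ### Rational modules -/

/-- A (right) comodule structure on the vector space `M` over the coalgebra `C`; for `C = k[G]`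
this is the structure of a rational `G`-module. -/
structure RatModule (k C M : Type*) [Field k] [AddCommGroup C] [Module k C] [Coalgebra k C]
    [AddCommGroup M] [Module k M] where
  /-- the coaction `M → M ⊗ C` -/
  coact : M →ₗ[k] M ⊗[k] C
  coassoc : (TensorProduct.assoc k M C C).toLinearMap ∘ₗ coact.rTensor C ∘ₗ coact =
    (Coalgebra.comul (R := k) (A := C)).lTensor M ∘ₗ coact
  counit : (TensorProduct.rid k M).toLinearMap ∘ₗ
    (Coalgebra.counit (R := k) (A := C)).lTensor M ∘ₗ coact = LinearMap.id

namespace RatModule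

section

variable {k A B M : Type*} [Field k] [AddCommGroup M] [Module k M]
variable [CommRing A] [Bialgebra k A] [CommRing B] [Bialgebra k B]

/-- The pull-back (restriction) of a rational `G`-module along the homomorphism `H → G` with
comorphism `ψ : k[G] → k[H]`. -/
def pullback (ρ : RatModule k A M) (ψ : A →ₐc[k] B) : RatModule k B M where
  coact := (ψ : A →ₐ[k] B).toLinearMap.lTensor M ∘ₗ ρ.coact
  coassoc := by
    have h1 : (TensorProduct.assoc k M B B).toLinearMap ∘ₗ
        ((ψ : A →ₐ[k] B).toLinearMap.lTensor M ∘ₗ ρ.coact).rTensor B ∘ₗ (ψ : A →ₐ[k] B).toLinearMap.lTensor M =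
        (TensorProduct.map (ψ : A →ₐ[k] B).toLinearMap (ψ : A →ₐ[k] B).toLinearMap).lTensor M ∘ₗ
          (TensorProduct.assoc k M A A).toLinearMap ∘ₗ ρ.coact.rTensor A := by
      ext m a
      simp only [TensorProduct.AlgebraTensorModule.curry_apply, TensorProduct.curry_apply,
        LinearMap.coe_restrictScalars, LinearMap.comp_apply, LinearMap.lTensor_tmul,
        LinearMap.rTensor_tmul, LinearEquiv.coe_coe]
      induction ρ.coact m using TensorProduct.induction_on with
      | zero => simp
      | tmul x y => simp
      | add x y hx hy => simp only [map_add, TensorProduct.add_tmul, hx, hy]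
    have h2 : TensorProduct.map (ψ : A →ₐ[k] B).toLinearMap (ψ : A →ₐ[k] B).toLinearMap ∘ₗ Coalgebra.comul (R := k) =
        Coalgebra.comul (R := k) ∘ₗ (ψ : A →ₐ[k] B).toLinearMap := CoalgHomClass.map_comp_comul ψ
    have h3 := congrArg (fun g => g ∘ₗ ρ.coact) h1
    simp only [LinearMap.comp_assoc] at h3
    rw [h3, ρ.coassoc, ← LinearMap.comp_assoc, ← LinearMap.lTensor_comp, h2,
      LinearMap.lTensor_comp, LinearMap.comp_assoc]
  counit := by
    have h2 : Coalgebra.counit (R := k) ∘ₗ (ψ : A →ₐ[k] B).toLinearMap = Coalgebra.counit (R := k) :=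
      CoalgHomClass.counit_comp ψ
    have h3 := ρ.counit
    rw [← h2, LinearMap.lTensor_comp, LinearMap.comp_assoc] at h3
    exact h3

/-- The module is trivial: `Δ_M(m) = m ⊗ 1` for all `m`. -/
def IsTrivial (ρ : RatModule k A M) : Prop := ∀ m : M, ρ.coact m = m ⊗ₜ[k] (1 : A)

/-- The action of a functional `φ` on `k[G]`: `φ(m) = (1 ⊗ φ)(Δ_M(m))`. -/
def act (ρ : RatModule k A M) (φ : A →ₗ[k] k) : Module.End k M :=
  (TensorProduct.rid k M).toLinearMap ∘ₗ φ.lTensor M ∘ₗ ρ.coact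

end

end RatModule

/-- The vector space `M` with `t` acting by `θ` is a free `k[t]/t^p`-module, i.e. it is isomorphic
to a direct sum of copies of `k[t]/t^p`. -/
def IsFreeTrunc {k M : Type*} [Field k] [AddCommGroup M] [Module k M] (p : ℕ)
    (θ : Module.End k M) : Prop :=
  ∃ s : Set M, Nonempty
    (Module.AEval' θ ≃ₗ[k[X]] (s →₀ (k[X] ⧸ Ideal.span {(Polynomial.X : k[X]) ^ p})))

namespace ExpStructure

universe u v

variable {k : Type u} {A : Type v} [Field k] [CommRing A] [HopfAlgebra k A] {p : ℕ}
  [Fact p.Prime] [CharP k p]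
variable {M : Type*} [AddCommGroup M] [Module k M]

/-- The functional `(𝓔_B)_*(v_j)` on `k[G]`, which sends `f` to the coefficient of `X ^ j` in
`𝓔_B^*(f)`. -/
def expDist (S : ExpStructure k A p) (B : nilCone k A p) (j : ℕ) : A →ₗ[k] k :=
  Polynomial.lcoeff k j ∘ₗ (expAt S.E B).toLinearMap

/-- `k[G]_[d]`: the functions killed by `(𝓔_B)_*(v_j)` for all `B ∈ 𝒩_p` and `j > d`. -/
def coordFiltration (S : ExpStructure k A p) (d : ℕ) : Submodule k A :=
  ⨅ (B : nilCone k A p) (j : ℕ) (_ : d < j), LinearMap.ker (S.expDist B j)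

/-- `M_[d] = {m | Δ_M(m) ∈ M ⊗ k[G]_[d]}`: the filtration by exponential degree. -/
def filtration (S : ExpStructure k A p) (ρ : RatModule k A M) (d : ℕ) : Submodule k M :=
  (LinearMap.range ((S.coordFiltration d).subtype.lTensor M)).comap ρ.coact

/-- `M` is mock trivial: `M = M_[0]`. -/
def IsMockTrivial (S : ExpStructure k A p) (ρ : RatModule k A M) : Prop :=
  S.filtration ρ 0 = ⊤

/-- The `p`-nilpotent action on `M` at the 1-parameter subgroup `∏ (𝓔_{B_s} ∘ F^s)`: the action
of `∑_s (𝓔_{B_s})_*(u_s)`, where `u_s = v_{p^s}`. -/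
def nilpAction (S : ExpStructure k A p) (ρ : RatModule k A M) {r : ℕ}
    (B : commTuples k A p r) : Module.End k M :=
  ρ.act (∑ s : Fin r, S.expDist ⟨B.1 s, B.2.1 s⟩ (p ^ (s : ℕ)))

/-- The support variety of `M`, inside the set `V(G)` of all 1-parameter subgroups of `G`: those
`ψ = ∏ (𝓔_{B_s} ∘ F^s)` at which the `p`-nilpotent action on `M` is not free. -/
def supportVariety (S : ExpStructure k A p) (ρ : RatModule k A M) : Set (OneParam k A) :=
  {ψ | ∃ (r : ℕ) (B : commTuples k A p r), 0 < r ∧ (ψ : A →ₐ[k] k[X]) = expTuple S.E B ∧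
    ¬ IsFreeTrunc p (S.nilpAction ρ B)}

end ExpStructure

end AlgGroup

end

/-! Everything is read off from the functionals `S.expDist B j`, the coefficients of `𝓔_B^*`. Over a
field, `Δ_M(m)` lies in `M ⊗ k[G]_[0]` exactly when every functional defining `k[G]_[0]` kills it,
so mock triviality says that all `S.expDist B j` with `j > 0` act as zero
(`isMockTrivial_iff_act_eq_zero`). These actions are the positive coefficients of the coaction
pulled back along `𝓔_B`, and the constant coefficient is always the identity; hence mock triviality
means that each `𝓔_B`, as a `k[X]`-point of `G`, acts trivially (`expAt_mem_trivialPoints_iff`).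
Points acting trivially are closed under products and change of ring, so the products of the
`𝓔_{B_s} ∘ F^s`, that is all 1-parameter subgroups, act trivially as well. The `p`-nilpotent action
is a sum of actions of functionals with index `p ^ s > 0`, hence zero, and the zero operator on a
non-zero space is not free over `k[t]/t^p`. -/

/-! ### Tensors over a field, coordinate by coordinate. -/

namespace TensorProduct

variable {k M N N' : Type*} [Field k] [AddCommGroup M] [Module k M] [AddCommGroup N] [Module k N]
  [AddCommGroup N'] [Module k N']

theorem equivFinsuppOfBasisLeft_lTensor {ι : Type*} [DecidableEq ι] (b : Module.Basis ι k M)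
    (φ : N →ₗ[k] N') (x : M ⊗[k] N) (i : ι) :
    equivFinsuppOfBasisLeft b (φ.lTensor M x) i = φ (equivFinsuppOfBasisLeft b x i) := by
  induction x using TensorProduct.induction_on with
  | zero => simp
  | tmul m n => simp
  | add x y hx hy => simp only [map_add, Finsupp.add_apply, hx, hy]

/-- If `P` contains the common kernel of a family of linear maps on `N`, then every tensor in
`M ⊗ N` killed by the whole family lies in `M ⊗ P`. -/
theorem mem_range_lTensor_of_forall_eq_zero {J : Type*} (P : Submodule k N) (φ : J → N →ₗ[k] N')
    (hP : ∀ n, (∀ j, φ j n = 0) → n ∈ P) (x : M ⊗[k] N) (hx : ∀ j, (φ j).lTensor M x = 0) :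
    x ∈ LinearMap.range (P.subtype.lTensor M) := by
  classical
  let b := Module.Basis.ofVectorSpace k M
  have hmem : ∀ i, equivFinsuppOfBasisLeft b x i ∈ P := fun i => hP _ fun j => by
    rw [← equivFinsuppOfBasisLeft_lTensor, hx, map_zero, Finsupp.zero_apply]
  rw [← (equivFinsuppOfBasisLeft b).symm_apply_apply x, equivFinsuppOfBasisLeft_symm_apply]
  exact Submodule.sum_mem _ fun i _ => ⟨b i ⊗ₜ ⟨_, hmem i⟩, by simp⟩

theorem lTensor_eq_zero_of_mem_range {P : Submodule k N} {φ : N →ₗ[k] N'}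
    (hP : P ≤ LinearMap.ker φ) {x : M ⊗[k] N}
    (hx : x ∈ LinearMap.range (P.subtype.lTensor M)) : φ.lTensor M x = 0 := by
  obtain ⟨y, rfl⟩ := hx
  have h : φ ∘ₗ P.subtype = 0 := LinearMap.ext fun n => hP n.2
  rw [← LinearMap.lTensor_comp_apply, h, LinearMap.lTensor_zero, LinearMap.zero_apply]

/-- Two elements of `M ⊗ k[X]` agree if all their coefficients do. -/
theorem ext_lcoeff {x y : M ⊗[k] k[X]}
    (h : ∀ j, (Polynomial.lcoeff k j).lTensor M x = (Polynomial.lcoeff k j).lTensor M y) :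
    x = y := by
  classical
  apply (equivFinsuppOfBasisRight (M := M) (Polynomial.basisMonomials k)).injective
  ext j
  have hc : (Polynomial.basisMonomials k).coord j = Polynomial.lcoeff k j := by
    ext n
    simp [Polynomial.basisMonomials, Polynomial.coeff_monomial, Finsupp.single_apply]
  rw [equivFinsuppOfBasisRight_apply, equivFinsuppOfBasisRight_apply, hc, h]

end TensorProduct

namespace AlgGroup

/-! ### Points of `G` acting trivially on a rational module. -/

namespace RatModule

variable {k A M : Type*} [Field k] [AddCommGroup M] [Module k M] [CommRing A] [Bialgebra k A]

theorem act_eq_zero_iff (ρ : RatModule k A M) (φ : A →ₗ[k] k) :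
    ρ.act φ = 0 ↔ ∀ m, φ.lTensor M (ρ.coact m) = 0 := by
  simp [act, LinearMap.ext_iff]

theorem lTensor_counit (ρ : RatModule k A M) (m : M) :
    (Coalgebra.counit (R := k) (A := A)).lTensor M (ρ.coact m) = m ⊗ₜ[k] (1 : k) := by
  apply (TensorProduct.rid k M).injective
  simpa using LinearMap.congr_fun ρ.counit m

/-- The submonoid of those `R`-points of `G` that act trivially on `M`. -/
def trivialPoints (ρ : RatModule k A M) (R : Type*) [CommRing R] [Algebra k R] :
    Submonoid (WithConv (A →ₐ[k] R)) where
  carrier := {φ | ∀ m, φ.ofConv.toLinearMap.lTensor M (ρ.coact m) = m ⊗ₜ[k] (1 : R)}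
  one_mem' m := by
    have h : (1 : WithConv (A →ₐ[k] R)).ofConv.toLinearMap =
        Algebra.linearMap k R ∘ₗ Coalgebra.counit (R := k) := rfl
    rw [h, LinearMap.lTensor_comp_apply, lTensor_counit]
    simp
  mul_mem' {φ χ} hφ hχ m := by
    have h1 : (φ * χ).ofConv.toLinearMap = LinearMap.mul' k R ∘ₗ
        TensorProduct.map φ.ofConv.toLinearMap χ.ofConv.toLinearMap ∘ₗ Coalgebra.comul (R := k) :=
      congrArg ofConv (AlgHom.toLinearMap_convMul φ χ)
    -- With `y = ρ.coact m` and coassociativity, this splits the action of `φ * χ` into that of `χ`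
    -- followed by that of `φ`.
    have h2 : ∀ y : M ⊗[k] A,
        (TensorProduct.map φ.ofConv.toLinearMap χ.ofConv.toLinearMap).lTensor M
          (TensorProduct.assoc k M A A (ρ.coact.rTensor A y)) =
        TensorProduct.assoc k M R R
          ((φ.ofConv.toLinearMap.lTensor M ∘ₗ ρ.coact).rTensor R
            (χ.ofConv.toLinearMap.lTensor M y)) := by
      intro y
      induction y using TensorProduct.induction_on with
      | zero => simp
      | add x y hx hy => simp only [map_add, hx, hy]
      | tmul n a =>
        simp only [LinearMap.rTensor_tmul, LinearMap.lTensor_tmul, LinearMap.comp_apply]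
        induction ρ.coact n using TensorProduct.induction_on with
        | zero => simp
        | tmul x y => simp
        | add x y hx hy => simp only [map_add, TensorProduct.add_tmul, hx, hy]
    have h3 := LinearMap.congr_fun ρ.coassoc m
    simp only [LinearMap.comp_apply, LinearEquiv.coe_coe] at h3
    rw [h1, LinearMap.lTensor_comp_apply, LinearMap.lTensor_comp_apply, ← h3, h2, hχ m,
      LinearMap.rTensor_tmul, LinearMap.comp_apply, hφ m]
    simp

theorem mem_trivialPoints {ρ : RatModule k A M} {R : Type*} [CommRing R] [Algebra k R]
    {φ : WithConv (A →ₐ[k] R)} : φ ∈ ρ.trivialPoints R ↔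
      ∀ m, φ.ofConv.toLinearMap.lTensor M (ρ.coact m) = m ⊗ₜ[k] (1 : R) :=
  Iff.rfl

/-- Needed for precomposition with powers of Frobenius, where `f` is `Polynomial.expand`. -/
theorem comp_mem_trivialPoints {ρ : RatModule k A M} {R R' : Type*} [CommRing R] [Algebra k R]
    [CommRing R'] [Algebra k R'] (f : R →ₐ[k] R') {φ : A →ₐ[k] R}
    (h : toConv φ ∈ ρ.trivialPoints R) : toConv (f.comp φ) ∈ ρ.trivialPoints R' := by
  intro m
  change (f.toLinearMap ∘ₗ φ.toLinearMap).lTensor M (ρ.coact m) = _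
  rw [LinearMap.lTensor_comp_apply]
  erw [h m]
  simp

theorem pullback_isTrivial_iff {B : Type*} [CommRing B] [Bialgebra k B] (ρ : RatModule k A M)
    (ψ : A →ₐc[k] B) :
    (ρ.pullback ψ).IsTrivial ↔ toConv (ψ : A →ₐ[k] B) ∈ ρ.trivialPoints B :=
  Iff.rfl

end RatModule

/-- Under the zero operator `X` kills everything, but it does not kill the generator of a summand
`k[X]/(X ^ p)` when `p > 1`. -/
theorem not_isFreeTrunc_zero {k M : Type*} [Field k] [AddCommGroup M] [Module k M] [Nontrivial M]
    {p : ℕ} (hp : 1 < p) : ¬ IsFreeTrunc p (0 : Module.End k M) := by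
  rintro ⟨s, ⟨e⟩⟩
  obtain ⟨m, hm⟩ := exists_ne (0 : M)
  -- A non-zero image is used to see that there is at least one summand, indexed by `i`.
  have hne : e (Module.AEval'.of 0 m) ≠ 0 := by simpa using hm
  obtain ⟨i, -⟩ := Finsupp.ne_iff.1 hne
  obtain ⟨n, hn⟩ := (Module.AEval'.of (0 : Module.End k M)).surjective
    (e.symm (Finsupp.single i (Ideal.Quotient.mk _ 1)))
  have h1 : (Polynomial.X : k[X]) • e.symm (Finsupp.single i (Ideal.Quotient.mk _ 1)) = 0 := by
    rw [← hn, Module.AEval'.X_smul_of, LinearMap.zero_apply, map_zero]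
  rw [← map_smul, map_eq_zero_iff e.symm e.symm.injective, Finsupp.smul_single,
    Finsupp.single_eq_zero] at h1
  have h2 : Ideal.Quotient.mk (Ideal.span {(Polynomial.X : k[X]) ^ p}) Polynomial.X = 0 := by
    rw [← h1]
    change _ = Ideal.Quotient.mk _ (Polynomial.X * 1)
    rw [mul_one]
  rw [Ideal.Quotient.eq_zero_iff_mem, Ideal.mem_span_singleton,
    Polynomial.X_pow_dvd_iff] at h2
  simpa using h2 1 hp

/-! ### Mock triviality, 1-parameter subgroups and support varieties. -/

namespace ExpStructure

universe u v

variable {k : Type u} {A : Type v} [Field k] [CommRing A] [HopfAlgebra k A] {p : ℕ}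
  [Fact p.Prime] [CharP k p]
variable {M : Type*} [AddCommGroup M] [Module k M]

theorem isMockTrivial_iff_act_eq_zero (S : ExpStructure k A p) (ρ : RatModule k A M) :
    S.IsMockTrivial ρ ↔ ∀ (B : nilCone k A p) (j : ℕ), 0 < j → ρ.act (S.expDist B j) = 0 := by
  simp only [RatModule.act_eq_zero_iff, IsMockTrivial, Submodule.eq_top_iff']
  constructor
  · intro h B j hj m
    refine TensorProduct.lTensor_eq_zero_of_mem_range ?_ (h m)
    exact (iInf_le _ B).trans ((iInf_le _ j).trans (iInf_le _ hj))
  · intro h m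
    refine TensorProduct.mem_range_lTensor_of_forall_eq_zero _
      (fun x : nilCone k A p × {j : ℕ // 0 < j} => S.expDist x.1 x.2) ?_ _
      fun x => h x.1 x.2 x.2.2 m
    intro f hf
    simp only [coordFiltration, Submodule.mem_iInf, LinearMap.mem_ker]
    exact fun B j hj => hf (B, ⟨j, hj⟩)

/-- The constant coefficient is evaluation at the identity of `𝔾ₐ`, which the homomorphism `𝓔_B`
sends to the identity of `G`. -/
theorem expDist_zero (S : ExpStructure k A p) (B : nilCone k A p) :
    S.expDist B 0 = Coalgebra.counit (R := k) := by
  obtain ⟨ψ, hψ⟩ := S.oneParam B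
  ext f
  have h : Coalgebra.counit (R := k) (ψ f) = Coalgebra.counit (R := k) f :=
    CoalgHomClass.counit_comp_apply ψ f
  rw [← h, AdditiveGroup.counit_eq, expDist, ← hψ, ← Polynomial.coeff_zero_eq_aeval_zero]
  rfl

theorem expAt_mem_trivialPoints_iff (S : ExpStructure k A p) (ρ : RatModule k A M)
    (B : nilCone k A p) : toConv (expAt S.E B) ∈ ρ.trivialPoints k[X] ↔
      ∀ j, 0 < j → ρ.act (S.expDist B j) = 0 := by
  simp only [RatModule.act_eq_zero_iff, RatModule.mem_trivialPoints, expDist,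
    LinearMap.lTensor_comp_apply]
  constructor
  · intro h j hj m
    erw [h m]
    simp [Polynomial.coeff_one, hj.ne']
  · intro h m
    refine TensorProduct.ext_lcoeff fun j => ?_
    -- The coefficient `j = 0` is the counit axiom of `M`; the others must vanish because the target
    -- is `m ⊗ 1`.
    rcases Nat.eq_zero_or_pos j with rfl | hj
    · erw [← LinearMap.lTensor_comp_apply]
      change (S.expDist B 0).lTensor M _ = _
      rw [expDist_zero, RatModule.lTensor_counit]
      simp
    · refine (h j hj m).trans ?_
      simp [Polynomial.coeff_one, hj.ne']

theorem expTuple_mem_trivialPoints (S : ExpStructure k A p) (ρ : RatModule k A M)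
    (h : ∀ B : nilCone k A p, toConv (expAt S.E B) ∈ ρ.trivialPoints k[X])
    {r : ℕ} (B : commTuples k A p r) : toConv (expTuple S.E B) ∈ ρ.trivialPoints k[X] := by
  refine Submonoid.list_prod_mem _ fun φ hφ => ?_
  obtain ⟨s, rfl⟩ := List.mem_ofFn.1 hφ
  exact RatModule.comp_mem_trivialPoints _ (h _)

theorem isMockTrivial_iff_pullback_isTrivial (S : ExpStructure k A p) (ρ : RatModule k A M) :
    S.IsMockTrivial ρ ↔ ∀ ψ : OneParam k A, (ρ.pullback ψ).IsTrivial := by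
  simp only [isMockTrivial_iff_act_eq_zero, ← expAt_mem_trivialPoints_iff,
    RatModule.pullback_isTrivial_iff]
  constructor
  · intro h ψ
    obtain ⟨r, -, B, hB⟩ := S.exists_tuple ψ
    rw [hB]
    exact S.expTuple_mem_trivialPoints ρ h B
  · intro h B
    obtain ⟨ψ, hψ⟩ := S.oneParam B
    exact hψ ▸ h ψ

theorem IsMockTrivial.nilpAction_eq_zero {S : ExpStructure k A p} {ρ : RatModule k A M}
    (h : S.IsMockTrivial ρ) {r : ℕ} (B : commTuples k A p r) : S.nilpAction ρ B = 0 := by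
  rw [isMockTrivial_iff_act_eq_zero] at h
  have hp : 0 < p := (Fact.out : p.Prime).pos
  simp only [RatModule.act_eq_zero_iff] at h
  rw [nilpAction, RatModule.act_eq_zero_iff]
  intro m
  rw [← LinearMap.coe_lTensorHom, map_sum, LinearMap.sum_apply]
  -- Since `p ^ s > 0` for every `s`, including `s = 0`, the functional with index `0` never occurs
  -- in the sum.
  exact Finset.sum_eq_zero fun s _ => h _ _ (pow_pos hp _) m

theorem supportVariety_eq_univ (S : ExpStructure k A p) (ρ : RatModule k A M) [Nontrivial M]
    (h : ∀ (ψ : OneParam k A) (r : ℕ) (B : commTuples k A p r), 0 < r →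
      (ψ : A →ₐ[k] k[X]) = expTuple S.E B → S.nilpAction ρ B = 0) :
    S.supportVariety ρ = Set.univ := by
  refine Set.eq_univ_of_forall fun ψ => ?_
  -- Membership in the support variety asks for one presentation of `ψ` with non-free action, so any
  -- presentation serves as a witness.
  obtain ⟨r, hr, B, hB⟩ := S.exists_tuple ψ
  refine ⟨r, B, hr, hB, ?_⟩
  rw [h ψ r B hr hB]
  exact not_isFreeTrunc_zero (Fact.out : p.Prime).one_lt

end ExpStructure

end AlgGroup

theorem mainTheorem11 {p : ℕ} [Fact p.Prime] {k : Type*} [Field k] [IsAlgClosed k] [CharP k p]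
    {A : Type*} [CommRing A] [HopfAlgebra k A] [Algebra.FiniteType k A] [IsReduced A]
    (S : AlgGroup.ExpStructure k A p)
    {M : Type*} [AddCommGroup M] [Module k M] (ρ : AlgGroup.RatModule k A M) :
    (S.IsMockTrivial ρ ↔ ∀ ψ : AlgGroup.OneParam k A, (ρ.pullback ψ).IsTrivial) ∧
    (S.IsMockTrivial ρ →
      (∀ (ψ : AlgGroup.OneParam k A) (r : ℕ) (B : AlgGroup.commTuples k A p r), 0 < r →
        (ψ : A →ₐ[k] k[X]) = AlgGroup.expTuple S.E B → S.nilpAction ρ B = 0) ∧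
      (Nontrivial M → S.supportVariety ρ = Set.univ)) ∧
    ((∀ (ψ : AlgGroup.OneParam k A) (r : ℕ) (B : AlgGroup.commTuples k A p r), 0 < r →
        (ψ : A →ₐ[k] k[X]) = AlgGroup.expTuple S.E B → S.nilpAction ρ B = 0) →
      Nontrivial M → S.supportVariety ρ = Set.univ) := by

  refine ⟨S.isMockTrivial_iff_pullback_isTrivial ρ, fun h => ?_, fun h _ =>
    S.supportVariety_eq_univ ρ h⟩
  have h0 : ∀ (ψ : AlgGroup.OneParam k A) (r : ℕ) (B : AlgGroup.commTuples k A p r), 0 < r →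
      (ψ : A →ₐ[k] k[X]) = AlgGroup.expTuple S.E B → S.nilpAction ρ B = 0 :=
    fun _ _ B _ _ => h.nilpAction_eq_zero B
  exact ⟨h0, fun _ => S.supportVariety_eq_univ ρ h0⟩
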